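/- Let $A$ be a unital associative finite-dimensional semisimple $\mathbb{R}$-algebra with its canonical (Euclidean) topology, and let $\sigma\colon A\to A$ be an anti-involution, i.e. an $\mathbb{R}$-linear map with $\sigma(ab)=\sigma(b)\sigma(a)$ and $\sigma^2=\mathrm{Id}$. Put $A^\sigma=\{a\in A\mid\sigma(a)=a\}$ and $A^\sigma_{\ge 0}=\{x^2\mid x\in A^\sigma\}$. Assume that $(A,\sigma)$ is Hermitian, i.e. for all $x,y\in A^\sigma$ the relation $x^2+y^2=0$ implies $x=y=0$, and that $a\,\sigma(a)\in A^\sigma_{\ge 0}$ for every $a\in A^\times$. Let $\omega(x,y)=\sigma(x)^t\begin{pmatrix}0&1\\1&0\end{pmatrix}y$ be the standard indefinite orthogonal form on the right $A$-module $A^2$ of columns, and let $$\mathrm{O}_{(1,1)}(A,\sigma)=\{g\in \mathrm{GL}_2(A)\mid \omega(gx,gy)=\omega(x,y)\text{ for all }x,y\in A^2\},$$ where $\mathrm{GL}_2(A)=\mathrm{Mat}_2(A)^\times$. If $A^\times$ has $n$ connected components, then $\mathrm{O}_{(1,1)}(A,\sigma)$ has $n^2$ connected components. Moreover, $\mathrm{O}_{(1,1)}(A,\sigma)$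 is connected if and only if $A^\times$ is connected. -/

import Mathlib

open scoped Matrix

namespace HermAlg

/-!
Throughout, an anti-involution on a real algebra `A` is Mathlib's `StarRing A` together with
`StarModule ℝ A`: the map `σ = star` is then `ℝ`-linear (the star of `ℝ` is trivial), satisfies
`σ (a * b) = σ b * σ a` and squares to the identity.
-/

/-- The set of `σ`-symmetric elements, the fixed points of `σ`. -/
def symmElems (A : Type*) [Ring A] [StarRing A] : Set A := {a | star a = a}

/-- The set of `σ`-non-negative elements, the squares of `σ`-symmetric elements. -/
def nonnegCone (A : Type*) [Ring A] [StarRing A] : Set A := {b | ∃ x ∈ symmElems A, b = x ^ 2}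

/-- `(A, σ)` is Hermitian: `x² + y² = 0` with `x`, `y` symmetric forces `x = y = 0`. -/
def IsHermitian (A : Type*) [Ring A] [StarRing A] : Prop :=
  ∀ x ∈ symmElems A, ∀ y ∈ symmElems A, x ^ 2 + y ^ 2 = 0 → x = 0 ∧ y = 0

/-- The matrix `Ω` of the standard indefinite orthogonal form. -/
def Omega (A : Type*) [Ring A] : Matrix (Fin 2) (Fin 2) A := !![0, 1; 1, 0]

/-- The standard indefinite orthogonal form `ω(x, y) = σ(x)ᵗ Ω y` on columns `x, y ∈ A²`. -/
def form {A : Type*} [Ring A] [StarRing A] (x y : Fin 2 → A) : A :=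
  star x ⬝ᵥ (Omega A *ᵥ y)

/-- The group `O_{(1,1)}(A, σ)` of symmetries of `ω`. Automorphisms of the right module `A²` of
columns are left multiplications by elements of `GL₂(A)`, the unit group of `Mat₂(A)`. As a
subgroup of that topological group it carries the subspace topology. -/
def O11 (A : Type*) [Ring A] [StarRing A] : Subgroup (Matrix (Fin 2) (Fin 2) A)ˣ where
  carrier := {g | ∀ x y : Fin 2 → A, form (g.val *ᵥ x) (g.val *ᵥ y) = form x y}
  one_mem' := by
    intro x y
    simp
  mul_mem' := by
    intro g h hg hh x y
    rw [Units.val_mul, ← Matrix.mulVec_mulVec, ← Matrix.mulVec_mulVec, hg, hh]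
  inv_mem' := by
    intro g hg x y
    rw [← hg, Matrix.mulVec_mulVec, Matrix.mulVec_mulVec, Units.mul_inv, Matrix.one_mulVec,
      Matrix.one_mulVec]

end HermAlg

namespace HermAlg

section PositiveTrace

open Polynomial

variable {A : Type*} [Ring A] [StarRing A] [Algebra ℝ A] [StarModule ℝ A]

theorem star_aeval_of_mem_symmElems {s : A} (hs : star s = s) (r : ℝ[X]) :
    star (aeval s r) = aeval s r := by
  induction r using Polynomial.induction_on' with
  | add p q hp hq => simp [hp, hq]
  | monomial n c => simp [aeval_monomial, hs, ← Algebra.smul_def]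

omit [StarRing A] [StarModule ℝ A] in
theorem aeval_ne_zero_of_minpoly_eq_mul [FiniteDimensional ℝ A] {s : A} {q r : ℝ[X]}
    (hq : 0 < q.natDegree) (h : minpoly ℝ s = q * r) : aeval s r ≠ 0 := by
  intro h0
  have hm : minpoly ℝ s ≠ 0 := minpoly.ne_zero (IsIntegral.of_finite ℝ s)
  have hr : r ≠ 0 := by rintro rfl; simp at h; exact hm h
  have hq0 : q ≠ 0 := by rintro rfl; simp at hq
  have h1 := natDegree_le_of_dvd (minpoly.dvd ℝ s h0) hr
  rw [h, natDegree_mul hq0 hr] at h1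
  omega

theorem nonneg_root_minpoly_sq [FiniteDimensional ℝ A] (hH : IsHermitian A) {y : A}
    (hy : star y = y) {μ : ℂ} (hμ : aeval μ (minpoly ℝ (y ^ 2)) = 0) : μ.im = 0 ∧ 0 ≤ μ.re := by
  have hs : star (y ^ 2) = y ^ 2 := by simp [hy]
  have him : μ.im = 0 := by
    by_contra him
    obtain ⟨r, hr⟩ := Polynomial.quadratic_dvd_of_aeval_eq_zero_im_ne_zero _ hμ him
    set s := y ^ 2 with hsdef
    refine aeval_ne_zero_of_minpoly_eq_mul ?_ hr ?_
    · have : natDegree (X ^ 2 - C (2 * μ.re) * X + C (‖μ‖ ^ 2)) = 2 := by compute_degree!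
      omega
    have h0 : aeval s (minpoly ℝ s) = 0 := minpoly.aeval ℝ s
    have h1 := hH (aeval s ((X - C μ.re) * r)) (star_aeval_of_mem_symmElems hs _)
      (aeval s (C μ.im * r)) (star_aeval_of_mem_symmElems hs _) ?_
    · have h2 := h1.2
      rw [map_mul, aeval_C, ← Algebra.smul_def] at h2
      exact (smul_eq_zero.mp h2).resolve_left him
    · rw [← map_pow, ← map_pow, ← map_add]
      have : ((X - C μ.re) * r) ^ 2 + (C μ.im * r) ^ 2 = minpoly ℝ s * r := by
        have hn : ‖μ‖ ^ 2 = μ.re ^ 2 + μ.im ^ 2 := by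
          rw [← Complex.normSq_eq_norm_sq, Complex.normSq_apply]; ring
        rw [hr, hn]
        simp only [map_mul, map_add, map_pow, map_ofNat]
        ring
      rw [this, map_mul, h0, zero_mul]
  refine ⟨him, ?_⟩
  by_contra! hneg
  have hμ' : (minpoly ℝ (y ^ 2)).IsRoot μ.re := by
    have : μ = algebraMap ℝ ℂ μ.re := Complex.ext (by simp) (by simp [him])
    rw [this, aeval_algebraMap_apply] at hμ
    simpa using hμ
  obtain ⟨r, hr⟩ := dvd_iff_isRoot.mpr hμ'
  have hf := aeval_ne_zero_of_minpoly_eq_mul (by simp) hr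
  set f := aeval (y ^ 2) r with hfdef
  have h0 : aeval (y ^ 2) (minpoly ℝ (y ^ 2)) = 0 := minpoly.aeval ℝ _
  have hcomm : y * f = f * y := by
    have h : f = aeval y (r.comp (X ^ 2)) := by rw [aeval_comp]; simp [hfdef]
    have := (Commute.all X (r.comp (X ^ 2))).map (aeval y)
    rw [aeval_X, ← h] at this
    exact this.eq
  have hsf : star f = f := star_aeval_of_mem_symmElems hs _
  have hc : √(-μ.re) ^ 2 = -μ.re := Real.sq_sqrt (by linarith)
  have hrel : (y ^ 2) * f - μ.re • f = 0 := by
    rw [hr] at h0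
    simpa [sub_mul, ← Algebra.smul_def] using h0
  have h1 := hH (y * f) (by simp [symmElems, hy, hsf, hcomm]) (√(-μ.re) • f)
    (by simp [symmElems, hsf]) (by
      have e1 : (y * f) ^ 2 = (y ^ 2 * f) * f := by
        rw [pow_two, mul_assoc, ← mul_assoc f, ← hcomm]; simp only [pow_two, mul_assoc]
      rw [e1, _root_.smul_pow, hc, sub_eq_zero.mp hrel, pow_two]
      simp)
  refine hf ((smul_eq_zero.mp h1.2).resolve_left ?_)
  exact (Real.sqrt_pos.mpr (by linarith)).ne'

theorem trace_mulLeft_sq_nonneg [FiniteDimensional ℝ A] (hH : IsHermitian A) {y : A}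
    (hy : star y = y) : 0 ≤ LinearMap.trace ℝ A (LinearMap.mulLeft ℝ (y ^ 2)) := by
  classical
  let b := Module.finBasis ℝ A
  let N := LinearMap.toMatrix b b (LinearMap.mulLeft ℝ (y ^ 2))
  rw [LinearMap.trace_eq_matrix_trace ℝ b]
  have hN : aeval N (minpoly ℝ (y ^ 2)) = 0 := by
    have : aeval N (minpoly ℝ (y ^ 2)) =
        ((LinearMap.toMatrixAlgEquiv b).toAlgHom.comp (Algebra.lmul ℝ A))
          (aeval (y ^ 2) (minpoly ℝ (y ^ 2))) := by
      rw [← aeval_algHom_apply]; rfl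
    rw [this, minpoly.aeval, map_zero]
  let NC : Matrix _ _ ℂ := N.map (algebraMap ℝ ℂ)
  have hNC : aeval NC ((minpoly ℝ (y ^ 2)).map (algebraMap ℝ ℂ)) = 0 := by
    have : aeval NC ((minpoly ℝ (y ^ 2)).map (algebraMap ℝ ℂ)) =
        (Algebra.ofId ℝ ℂ).mapMatrix (aeval N (minpoly ℝ (y ^ 2))) := by
      rw [← aeval_algHom_apply, aeval_map_algebraMap]; rfl
    rw [this, hN, map_zero]
  have htr : ((N.trace : ℝ) : ℂ) = NC.charpoly.roots.sum := by
    rw [← Matrix.trace_eq_sum_roots_charpoly]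
    simp [Matrix.trace, NC]
  have hroot : ∀ μ ∈ NC.charpoly.roots, μ.im = 0 ∧ 0 ≤ μ.re := by
    intro μ hμ
    have h1 : Module.End.HasEigenvalue (Matrix.toLin' NC) μ := by
      rw [Module.End.hasEigenvalue_iff_isRoot_charpoly]
      simpa using (mem_roots'.mp hμ).2
    obtain ⟨v, hv⟩ := h1.exists_hasEigenvector
    have h2 := Module.End.aeval_apply_of_hasEigenvector
      (p := (minpoly ℝ (y ^ 2)).map (algebraMap ℝ ℂ)) hv
    have h3 : aeval (Matrix.toLin' NC) ((minpoly ℝ (y ^ 2)).map (algebraMap ℝ ℂ)) = 0 := by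
      have := aeval_algHom_apply (Matrix.toLinAlgEquiv' (R := ℂ)).toAlgHom NC
        ((minpoly ℝ (y ^ 2)).map (algebraMap ℝ ℂ))
      rw [hNC, map_zero] at this
      exact this
    rw [h3, LinearMap.zero_apply, eq_comm] at h2
    refine nonneg_root_minpoly_sq hH hy ?_
    have := (smul_eq_zero.mp h2).resolve_right hv.2
    simpa [eval_map_algebraMap] using this
  have : 0 ≤ (NC.charpoly.roots.sum).re := by
    have : (NC.charpoly.roots.sum).re = (NC.charpoly.roots.map Complex.reAddGroupHom).sum := 
      map_multiset_sum Complex.reAddGroupHom _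
    rw [this]
    refine Multiset.sum_nonneg fun x hx => ?_
    obtain ⟨μ, hμ, rfl⟩ := Multiset.mem_map.mp hx
    exact (hroot μ hμ).2
  rw [← htr, Complex.ofReal_re] at this
  exact this

end PositiveTrace

section Faithful

variable {A : Type*} [Ring A] [StarRing A] [Algebra ℝ A]

omit [StarRing A] in
theorem finite_setOf_not_isUnit_add_algebraMap [FiniteDimensional ℝ A] (x : A) :
    {t : ℝ | ¬ IsUnit (x + algebraMap ℝ A t)}.Finite := by
  refine ((Module.End.finite_spectrum (LinearMap.mulLeft ℝ x)).preimage
    neg_injective.injOn).subset fun t ht => ?_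
  rw [Set.mem_preimage, spectrum.mem_iff]
  contrapose! ht
  have h2 : algebraMap ℝ (Module.End ℝ A) (-t) - LinearMap.mulLeft ℝ x =
      - LinearMap.mulLeft ℝ (x + algebraMap ℝ A t) := by
    ext y
    simp [add_mul, Algebra.smul_def, sub_eq_add_neg, add_comm]
  rw [h2] at ht
  have ht' : IsUnit (LinearMap.mulLeft ℝ (x + algebraMap ℝ A t) : Module.End ℝ A) :=
    (IsUnit.neg_iff (α := Module.End ℝ A) _).mp ht
  obtain ⟨y, hy⟩ := ((Module.End.isUnit_iff _).mp ht').2 1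
  simp only [Set.mem_ofPred_eq, not_not]
  have := IsArtinianRing.of_finite ℝ A
  exact IsUnit.of_mul_eq_one y hy

theorem trace_mulLeft_star_mul_self_nonneg [StarModule ℝ A] [FiniteDimensional ℝ A]
    (hH : IsHermitian A)
    (hpos : ∀ a : Aˣ, (a : A) * star (a : A) ∈ nonnegCone A) (x : A) :
    0 ≤ LinearMap.trace ℝ A (LinearMap.mulLeft ℝ (star x * x)) := by
  let τ : A →ₗ[ℝ] ℝ := LinearMap.trace ℝ A ∘ₗ LinearMap.mul ℝ A
  change 0 ≤ τ (star x * x)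
  have hunit : ∀ y : A, IsUnit y → 0 ≤ τ (star y * y) := by
    rintro _ ⟨u, rfl⟩
    obtain ⟨z, hz, h⟩ := hpos (star u)
    rw [Units.coe_star, star_star] at h
    rw [h]
    exact trace_mulLeft_sq_nonneg hH hz
  let q : ℝ → ℝ := fun t => τ (star x * x) + t * τ (star x + x) + t ^ 2 * τ 1
  have hq : ∀ t, q t = τ (star (x + algebraMap ℝ A t) * (x + algebraMap ℝ A t)) := by
    intro t
    simp only [q]
    have : star (x + algebraMap ℝ A t) * (x + algebraMap ℝ A t) =
        star x * x + t • (star x + x) + t ^ 2 • (1 : A) := by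
      simp only [Algebra.algebraMap_eq_smul_one, star_add, star_smul, star_trivial, star_one,
        add_mul, mul_add, smul_mul_assoc, mul_smul_comm, one_mul, mul_one, smul_add, smul_smul]
      rw [pow_two]
      abel
    rw [this]
    simp [mul_add]
  have hcont : Continuous q := by fun_prop
  have hcl : IsClosed {t | 0 ≤ q t} := isClosed_le continuous_const hcont
  have hd : Dense {t | 0 ≤ q t} := by
    refine ((finite_setOf_not_isUnit_add_algebraMap x).countable.dense_compl ℝ).mono ?_
    intro t ht
    simp only [Set.mem_compl_iff, Set.mem_ofPred_eq, not_not] at ht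
    rw [Set.mem_ofPred_eq, hq]
    exact hunit _ ht
  have h0 : (0 : ℝ) ∈ {t | 0 ≤ q t} := by
    rw [← hcl.closure_eq, hd.closure_eq]; trivial
  simpa [q] using h0

/-- The symmetrised regular trace `z ↦ tr (L_z) + tr (L_{σ z})`. -/
noncomputable def symmTrace (A : Type*) [Ring A] [StarRing A] [Algebra ℝ A] [StarModule ℝ A] :
    A →ₗ[ℝ] ℝ :=
  LinearMap.trace ℝ A ∘ₗ LinearMap.mul ℝ A +
    (LinearMap.trace ℝ A ∘ₗ LinearMap.mul ℝ A) ∘ₗ (starLinearEquiv ℝ (A := A)).toLinearMap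

theorem symmTrace_apply [StarModule ℝ A] (z : A) : symmTrace A z =
    LinearMap.trace ℝ A (LinearMap.mulLeft ℝ z) +
      LinearMap.trace ℝ A (LinearMap.mulLeft ℝ (star z)) := rfl

theorem symmTrace_star [StarModule ℝ A] (z : A) : symmTrace A (star z) = symmTrace A z := by
  rw [symmTrace_apply, symmTrace_apply, star_star, add_comm]

theorem eq_zero_of_symmTrace_mul_eq_zero [StarModule ℝ A] [FiniteDimensional ℝ A]
    [IsSemisimpleRing A] {x : A} (h : ∀ y, symmTrace A (y * x) = 0) : x = 0 := by
  obtain ⟨e, he, hx⟩ := IsSemisimpleRing.ideal_eq_span_idempotent (Ideal.span {x})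
  have hidem : ∀ f : A, IsIdempotentElem f → IsIdempotentElem (LinearMap.mulLeft ℝ f) := by
    intro f hf
    rw [IsIdempotentElem, Module.End.mul_eq_comp, ← LinearMap.mulLeft_mul, hf.eq]
  have htr : ∀ f : A, IsIdempotentElem f →
      0 ≤ LinearMap.trace ℝ A (LinearMap.mulLeft ℝ f) := by
    intro f hf
    rw [(LinearMap.IsIdempotentElem.isProj_range _ (hidem f hf)).trace]
    positivity
  obtain ⟨y, hy⟩ := Ideal.mem_span_singleton'.mp (hx ▸ Ideal.mem_span_singleton_self e :
    e ∈ Ideal.span {x})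
  have h0 := h y
  rw [hy, symmTrace_apply] at h0
  have hes : IsIdempotentElem (star e) := by rw [IsIdempotentElem, ← star_mul, he.eq]
  have h1 : LinearMap.trace ℝ A (LinearMap.mulLeft ℝ e) = 0 := by
    linarith [htr e he, htr _ hes]
  have h2 := (LinearMap.IsIdempotentElem.trace_eq_zero_iff (hidem e he)).mp h1
  have h3 : e = 0 := by simpa using LinearMap.congr_fun h2 1
  rw [h3] at hx
  simpa using hx

theorem symmTrace_star_mul_self_nonneg [StarModule ℝ A] [FiniteDimensional ℝ A]
    (hH : IsHermitian A)
    (hpos : ∀ a : Aˣ, (a : A) * star (a : A) ∈ nonnegCone A) (x : A) :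
    0 ≤ symmTrace A (star x * x) := by
  have := trace_mulLeft_star_mul_self_nonneg hH hpos x
  rw [symmTrace_apply, star_mul, star_star]
  positivity

/-- The trace inner product `⟪x, y⟫ = T (σ(x) y)` on `A`. -/
noncomputable abbrev traceCore [StarModule ℝ A] [FiniteDimensional ℝ A] [IsSemisimpleRing A]
    (hH : IsHermitian A) (hpos : ∀ a : Aˣ, (a : A) * star (a : A) ∈ nonnegCone A) :
    InnerProductSpace.Core ℝ A where
  inner x y := symmTrace A (star x * y)
  conj_inner_symm x y := by
    rw [RCLike.conj_to_real, ← symmTrace_star, star_mul, star_star]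
  re_inner_nonneg x := symmTrace_star_mul_self_nonneg hH hpos x
  add_left x y z := by simp [add_mul]
  smul_left x y r := by simp
  definite x hx := by
    refine eq_zero_of_symmTrace_mul_eq_zero fun y => ?_
    have key : ∀ t : ℝ, 0 ≤ t ^ 2 * symmTrace A (y * star y) + 2 * t * symmTrace A (y * x) := by
      intro t
      have h := symmTrace_star_mul_self_nonneg hH hpos (t • star y + x)
      have h1 : symmTrace A (star x * star y) = symmTrace A (y * x) := by
        rw [← star_mul, symmTrace_star]
      simp only [star_add, star_smul, star_star, star_trivial, add_mul, mul_add, map_add,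
        smul_mul_assoc, mul_smul_comm, map_smul, smul_eq_mul, hx, h1] at h
      linarith
    by_contra hne
    have hd := discrim_le_zero (K := ℝ) (a := symmTrace A (y * star y))
      (b := 2 * symmTrace A (y * x)) (c := 0) (fun t => by linarith [key t])
    simp only [discrim] at hd
    have : 0 < (2 * symmTrace A (y * x)) ^ 2 := by positivity
    linarith

theorem exists_orthonormal_basis {V : Type*} [AddCommGroup V] [Module ℝ V]
    [FiniteDimensional ℝ V] (c : InnerProductSpace.Core ℝ V) :
    ∃ b : Module.Basis (Fin (Module.finrank ℝ V)) ℝ V, ∀ i (x : V), b.repr x i = c.inner (b i) x := by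
  let _ : NormedAddCommGroup V := c.toNormedAddCommGroup
  let _ : InnerProductSpace ℝ V := InnerProductSpace.ofCore c.toCore
  let b := stdOrthonormalBasis ℝ V
  refine ⟨b.toBasis, fun i x => ?_⟩
  rw [b.coe_toBasis_repr_apply, b.repr_apply_apply, b.coe_toBasis]

theorem exists_injective_starAlgHom_matrix [StarModule ℝ A] [FiniteDimensional ℝ A]
    [IsSemisimpleRing A] (hH : IsHermitian A)
    (hpos : ∀ a : Aˣ, (a : A) * star (a : A) ∈ nonnegCone A) :
    ∃ (n : ℕ) (π : A →⋆ₐ[ℝ] Matrix (Fin n) (Fin n) ℝ), Function.Injective π := by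
  obtain ⟨b, hb⟩ := exists_orthonormal_basis (traceCore hH hpos)
  have hb' : ∀ i x, b.repr x i = symmTrace A (star (b i) * x) := hb
  refine ⟨_, { Algebra.leftMulMatrix b with map_star' := fun a => ?_ },
    Algebra.leftMulMatrix_injective b⟩
  ext i j
  change Algebra.leftMulMatrix b (star a) i j = Algebra.leftMulMatrix b a j i
  rw [Algebra.leftMulMatrix_eq_repr_mul, Algebra.leftMulMatrix_eq_repr_mul, hb', hb',
    ← symmTrace_star]
  simp [mul_assoc]

end Faithful

section Positive

variable {A : Type*} [Ring A] [StarRing A] [Algebra ℝ A] {n : ℕ}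
  {π : A →⋆ₐ[ℝ] Matrix (Fin n) (Fin n) ℝ}

/-- Positive definiteness of an element with respect to a real matrix representation. -/
def IsPos (π : A →⋆ₐ[ℝ] Matrix (Fin n) (Fin n) ℝ) (s : A) : Prop := (π s).PosDef

theorem isUnit_of_isUnit_map [FiniteDimensional ℝ A] (hπ : Function.Injective π) {a : A}
    (h : IsUnit (π a)) : IsUnit a := by
  have hinj : Function.Injective (LinearMap.mulLeft ℝ a) := by
    intro x y hxy
    apply hπ
    apply h.mul_left_cancel
    rw [← map_mul, ← map_mul]
    exact congrArg π hxy
  obtain ⟨b, hb⟩ := LinearMap.surjective_of_injective hinj 1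
  have := IsArtinianRing.of_finite ℝ A
  exact IsUnit.of_mul_eq_one b hb

theorem IsPos.one : IsPos π 1 := by
  rw [IsPos, map_one]; exact Matrix.PosDef.one

theorem IsPos.star_eq (hπ : Function.Injective π) {s : A} (h : IsPos π s) : star s = s :=
  hπ (by rw [map_star]; exact h.isHermitian)

theorem IsPos.add {s t : A} (hs : IsPos π s) (ht : IsPos π t) : IsPos π (s + t) := by
  rw [IsPos, map_add]; exact Matrix.PosDef.add hs ht

theorem IsPos.smul {s : A} (hs : IsPos π s) {c : ℝ} (hc : 0 < c) : IsPos π (c • s) := by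
  rw [IsPos, map_smul]; exact Matrix.PosDef.smul hs hc

theorem IsPos.convexComb {s t : A} (hs : IsPos π s) (ht : IsPos π t) {c : ℝ}
    (hc : c ∈ Set.Icc (0 : ℝ) 1) : IsPos π ((1 - c) • s + c • t) := by
  rcases hc.1.eq_or_lt with rfl | h0
  · simpa using hs
  rcases hc.2.eq_or_lt with rfl | h1
  · simpa using ht
  exact (hs.smul (by linarith)).add (ht.smul h0)

theorem IsPos.isUnit [FiniteDimensional ℝ A] (hπ : Function.Injective π) {s : A}
    (h : IsPos π s) : IsUnit s :=
  isUnit_of_isUnit_map hπ (Matrix.PosDef.isUnit h)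

theorem IsPos.one_add_star_mul_self (c : A) : IsPos π (1 + star c * c) := by
  rw [IsPos, map_add, map_mul, map_star, map_one]
  exact Matrix.PosDef.one.add_posSemidef (Matrix.posSemidef_conjTranspose_mul_self _)

theorem isPos_mul_star_of_isUnit {a : A} (ha : IsUnit a) : IsPos π (a * star a) := by
  rw [IsPos, map_mul, map_star]
  exact Matrix.PosDef.mul_conjTranspose_self _
    (Matrix.vecMul_injective_iff_isUnit.mpr (ha.map π))

theorem isUnit_of_isPos_mul_add [FiniteDimensional ℝ A] (hπ : Function.Injective π) {p z : A}
    (h : IsPos π (p * z + star z * star p)) : IsUnit z := by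
  refine isUnit_of_isUnit_map hπ (Matrix.mulVec_injective_iff_isUnit.mp ?_)
  refine (injective_iff_map_eq_zero (Matrix.mulVecLin (π z))).mpr fun x hx => ?_
  by_contra hne
  have hx : π z *ᵥ x = 0 := hx
  have h1 := Matrix.PosDef.dotProduct_mulVec_pos h hne
  rw [map_add, map_mul, map_mul, map_star, Matrix.add_mulVec, ← Matrix.mulVec_mulVec, hx,
    Matrix.mulVec_zero, zero_add, ← Matrix.mulVec_mulVec, Matrix.dotProduct_mulVec,
    Matrix.star_eq_conjTranspose (π z), ← Matrix.star_mulVec, hx] at h1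
  simp at h1

theorem IsPos.exists_sqrt {s : A} (hs : IsPos π s) (hπ : Function.Injective π) :
    ∃ p : A, IsPos π p ∧ p * p = s := by
  classical
  have hM : (π s).PosDef := hs
  let d := hM.isHermitian.eigenvalues
  have hd : ∀ i, 0 < d i := hM.eigenvalues_pos
  let U := hM.isHermitian.eigenvectorUnitary
  have hspec : π s = Unitary.conjStarAlgAut ℝ _ U (Matrix.diagonal d) :=
    hM.isHermitian.spectral_theorem
  let f : Polynomial ℝ := Lagrange.interpolate (Finset.univ.image d) id Real.sqrt
  have hf : ∀ i, f.eval (d i) = √(d i) := fun i =>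
    Lagrange.eval_interpolate_at_node (v := id) _ Function.injective_id.injOn
      (Finset.mem_image_of_mem d (Finset.mem_univ i))
  have hp : π (Polynomial.aeval s f) =
      Unitary.conjStarAlgAut ℝ _ U (Matrix.diagonal fun i => √(d i)) := by
    have h1 : π (Polynomial.aeval s f) = Polynomial.aeval (π s) f :=
      (Polynomial.aeval_algHom_apply π.toAlgHom s f).symm
    have h2 : Polynomial.aeval (Unitary.conjStarAlgAut ℝ _ U (Matrix.diagonal d)) f =
        Unitary.conjStarAlgAut ℝ _ U (Polynomial.aeval (Matrix.diagonal d) f) :=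
      Polynomial.aeval_algHom_apply
        (Unitary.conjStarAlgAut ℝ (Matrix (Fin n) (Fin n) ℝ) U).toAlgEquiv.toAlgHom _ f
    have h3 : Polynomial.aeval (Matrix.diagonal d) f =
        Matrix.diagonal (Polynomial.aeval d f) :=
      Polynomial.aeval_algHom_apply (Matrix.diagonalAlgHom ℝ) d f
    rw [h1, hspec, h2, h3]
    congr 2
    ext i
    rw [Polynomial.aeval_pi_apply₂, ← hf]
    rfl
  refine ⟨Polynomial.aeval s f, ?_, ?_⟩
  · rw [IsPos, hp, Unitary.conjStarAlgAut_apply]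
    refine (Matrix.IsUnit.posDef_star_right_conjugate_iff (Unitary.isUnit_coe)).mpr ?_
    exact Matrix.PosDef.diagonal fun i => Real.sqrt_pos.mpr (hd i)
  · apply hπ
    rw [map_mul, hp, ← map_mul, Matrix.diagonal_mul_diagonal, hspec]
    congr 2
    ext i
    exact Real.mul_self_sqrt (hd i).le

omit [Algebra ℝ A] in
theorem star_val_inv_of_star_eq {q : Aˣ} (h : star (q : A) = q) : star (↑q⁻¹ : A) = ↑q⁻¹ := by
  have h' : star q = q := Units.ext h
  rw [← Units.coe_star_inv, h']

theorem exists_polar [FiniteDimensional ℝ A] (hπ : Function.Injective π) (a : Aˣ) :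
    ∃ p : A, IsPos π p ∧ ∃ w : unitary A, (a : A) = p * w := by
  obtain ⟨p, hp, hpp⟩ := (isPos_mul_star_of_isUnit (π := π) a.isUnit).exists_sqrt hπ
  obtain ⟨q, rfl⟩ := hp.isUnit hπ
  have hs : star (q : A) = q := hp.star_eq hπ
  have hqs : star (↑q⁻¹ : A) = ↑q⁻¹ := star_val_inv_of_star_eq hs
  refine ⟨q, hp, ⟨↑q⁻¹ * a, ?_⟩, by simp⟩
  have h1 : (↑q⁻¹ * (a : A)) * star (↑q⁻¹ * (a : A)) = 1 := by
    rw [star_mul, hqs, mul_assoc, ← mul_assoc (a : A), ← hpp]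
    simp
  exact (q⁻¹ * a).isUnit.mem_unitary_iff_mul_star_self.mpr h1

end Positive

section Components

theorem connectedComponents_mk_eq_of_path {X : Type*} [TopologicalSpace X] {f : unitInterval → X}
    (hf : Continuous f) : (f 0 : ConnectedComponents X) = f 1 :=
  ConnectedComponents.coe_eq_coe'.mpr <|
    (isPreconnected_range hf).subset_connectedComponent ⟨1, rfl⟩ ⟨0, rfl⟩

theorem connectedComponents_mk_map_eq {X Y : Type*} [TopologicalSpace X] [TopologicalSpace Y]
    {f : X → Y} (hf : Continuous f) {x y : X} (h : (x : ConnectedComponents X) = y) :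
    (f x : ConnectedComponents Y) = f y := by
  rw [← hf.connectedComponentsMap_mk, h, hf.connectedComponentsMap_mk]

theorem isOpen_setOf_forall_dotProduct_mulVec_pos (n : ℕ) :
    IsOpen {N : Matrix (Fin n) (Fin n) ℝ | ∀ x ≠ 0, 0 < x ⬝ᵥ (N *ᵥ x)} := by
  have heq : {N : Matrix (Fin n) (Fin n) ℝ | ∀ x ≠ 0, 0 < x ⬝ᵥ (N *ᵥ x)} =
      {N | ∀ x ∈ Metric.sphere (0 : Fin n → ℝ) 1, 0 < x ⬝ᵥ (N *ᵥ x)} := by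
    ext N
    refine ⟨fun h x hx => h x (ne_zero_of_mem_unit_sphere ⟨x, hx⟩), fun h x hx => ?_⟩
    have h1 := h (‖x‖⁻¹ • x) (by simp [norm_smul, hx])
    rw [Matrix.mulVec_smul, smul_dotProduct, dotProduct_smul, smul_eq_mul, smul_eq_mul,
      ← mul_assoc] at h1
    exact (pos_iff_pos_of_mul_pos h1).mp (by positivity)
  rw [heq, isOpen_iff_eventually]
  intro N hN
  refine (isCompact_sphere _ _).eventually_forall_of_forall_eventually fun x hx => ?_
  have hc : Continuous fun p : Matrix (Fin n) (Fin n) ℝ × (Fin n → ℝ) => p.2 ⬝ᵥ (p.1 *ᵥ p.2) := by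
    fun_prop
  exact hc.continuousAt.eventually (lt_mem_nhds (hN x hx))

variable {A : Type*} [Ring A] [StarRing A] [Algebra ℝ A] {n : ℕ}
  {π : A →⋆ₐ[ℝ] Matrix (Fin n) (Fin n) ℝ} [TopologicalSpace A]

theorem isOpen_setOf_isPos_add_star [IsTopologicalRing A] [ContinuousStar A]
    (hπ : Continuous π) : IsOpen {a : A | IsPos π (a + star a)} := by
  have : {a : A | IsPos π (a + star a)} =
      (fun a => π (a + star a)) ⁻¹' {N | ∀ x ≠ 0, 0 < x ⬝ᵥ (N *ᵥ x)} := by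
    ext a
    have hherm : (π (a + star a)).IsHermitian := by
      rw [Matrix.IsHermitian, ← Matrix.star_eq_conjTranspose, ← map_star, star_add, star_star,
        add_comm]
    change (π (a + star a)).PosDef ↔ _
    rw [Matrix.posDef_iff_dotProduct_mulVec, and_iff_right hherm]
    simp
  rw [this]
  exact (isOpen_setOf_forall_dotProduct_mulVec_pos n).preimage (by fun_prop)

theorem continuous_units_of_continuous_val (hπ : Topology.IsEmbedding π) {X : Type*}
    [TopologicalSpace X] {f : X → Aˣ} (hf : Continuous fun x => (f x : A)) : Continuous f := by
  refine Units.continuous_iff.mpr ⟨hf, hπ.continuous_iff.mpr ?_⟩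
  have h1 : ∀ x, π ↑(f x)⁻¹ = (π (f x)).det⁻¹ • (π (f x)).adjugate := by
    intro x
    rw [← Ring.inverse_eq_inv', ← Matrix.inv_def]
    refine (Matrix.inv_eq_left_inv ?_).symm
    rw [← map_mul, Units.inv_mul, map_one]
  have h2 : ∀ x, (π (f x)).det ≠ 0 := fun x =>
    ((Matrix.isUnit_iff_isUnit_det _).mp ((f x).isUnit.map π)).ne_zero
  have h3 : Continuous fun x => π (f x) := hπ.continuous.comp hf
  refine (continuous_congr h1).mpr ?_
  exact (h3.matrix_det.inv₀ h2).smul h3.matrix_adjugate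

variable [FiniteDimensional ℝ A] [IsTopologicalRing A] [ContinuousSMul ℝ A]

theorem connectedComponents_mk_eq_of_eq_isPos_mul (hπ : Topology.IsEmbedding π) {a w : Aˣ}
    {p : A} (hp : IsPos π p) (h : (a : A) = p * w) :
    (w : ConnectedComponents Aˣ) = a := by
  let e : unitInterval → Aˣ := fun t =>
    ((IsPos.one.convexComb hp t.2).isUnit hπ.injective).unit * w
  have hval : ∀ t, (e t : A) = ((1 - (t : ℝ)) • 1 + (t : ℝ) • p) * w := fun t => rfl
  have he : Continuous e := by
    refine continuous_units_of_continuous_val hπ ?_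
    simp_rw [hval]
    fun_prop
  convert connectedComponents_mk_eq_of_path he
  · ext; simp [hval]
  · ext; simp [hval, h]

theorem exists_unitary_connectedComponents_mk_eq (hπ : Topology.IsEmbedding π) (a : Aˣ) :
    ∃ w : unitary A, (Unitary.toUnits w : ConnectedComponents Aˣ) = a := by
  obtain ⟨p, hp, w, h⟩ := exists_polar hπ.injective a
  exact ⟨w, connectedComponents_mk_eq_of_eq_isPos_mul hπ hp h⟩

omit [Algebra ℝ A] [FiniteDimensional ℝ A] [TopologicalSpace A] [IsTopologicalRing A]
  [ContinuousSMul ℝ A] in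
theorem star_mul_inv_mem_unitary {e : Aˣ} (h : Commute (star (e : A)) e) :
    star (e : A) * ↑e⁻¹ ∈ unitary A := by
  have h' : star e * e = e * star e := Units.ext h
  have h1 : star e * e⁻¹ ∈ unitary Aˣ := by
    rw [Unitary.mem_iff, star_mul, star_star, star_inv]
    constructor
    · rw [mul_assoc, ← mul_assoc e, ← h']; group
    · rw [← mul_assoc, mul_assoc (star e), ← mul_inv_rev, h']; group
  rw [Units.unitary_eq] at h1
  exact h1

theorem connectedComponents_mk_one_eq_of_isUnit_one_add [StarModule ℝ A] [ContinuousStar A]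
    (hπ : Topology.IsEmbedding π) {w : unitary A} (h : IsUnit (1 + (w : A))) :
    ((1 : unitary A) : ConnectedComponents (unitary A)) = w := by
  obtain ⟨z, hz⟩ := h
  let c : A := (1 - w) * ↑z⁻¹
  have hcz : c * z = 1 - w := by simp [c, mul_assoc]
  have hc : star c = -c := by
    have h1 : star (z : A) * star c = 1 - star (w : A) := by
      rw [← star_mul, hcz]; simp
    have h2 : star (z : A) * (star c * z) = star (z : A) * (-c * z) := by
      rw [← mul_assoc, h1, neg_mul, hcz, hz]
      simp [mul_add, add_mul, mul_sub, sub_mul]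
      abel
    exact z.isUnit.mul_right_cancel (z.isUnit.star.mul_left_cancel h2)
  have hunit : ∀ t : ℝ, IsUnit (1 + t • c) := fun t => by
    refine isUnit_of_isPos_mul_add hπ.injective (p := 1) (π := π) ?_
    have : (1 : A) * (1 + t • c) + star (1 + t • c) * star 1 = 1 + 1 := by
      simp only [one_mul, star_add, star_one, star_smul, star_trivial, hc, smul_neg, mul_one]
      abel
    rw [this]
    exact IsPos.one.add IsPos.one
  let e : unitInterval → Aˣ := fun t => (hunit t).unit
  have hval : ∀ t, (e t : A) = 1 + (t : ℝ) • c := fun t => rfl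
  have hstar : ∀ t, star (e t : A) = 1 - (t : ℝ) • c := fun t => by
    simp [hval, hc, sub_eq_add_neg]
  have he : Continuous e := by
    refine continuous_units_of_continuous_val hπ ?_
    simp_rw [hval]
    fun_prop
  let f : unitInterval → unitary A := fun t => ⟨star (e t : A) * ↑(e t)⁻¹, by
    refine star_mul_inv_mem_unitary ?_
    rw [hstar, hval]
    exact ((Commute.one_left _).sub_left ((Commute.one_right _).add_right (Commute.refl _)))⟩
  have hf : Continuous f := by
    refine Continuous.subtype_mk ?_ _
    exact (Units.continuous_val.comp he).star.mul (Units.continuous_val.comp he.inv)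
  convert connectedComponents_mk_eq_of_path hf
  · apply Subtype.ext
    change (1 : A) = star (e 0 : A) * ↑(e 0)⁻¹
    rw [Units.eq_mul_inv_iff_mul_eq, hstar, hval]
    simp
  · apply Subtype.ext
    change (w : A) = star (e 1 : A) * ↑(e 1)⁻¹
    rw [Units.eq_mul_inv_iff_mul_eq, hstar, hval]
    refine z.isUnit.mul_right_cancel ?_
    simp only [Set.Icc.coe_one, one_smul]
    rw [mul_assoc, add_mul, sub_mul, one_mul, hcz, hz]
    noncomm_ring

theorem connectedComponents_mk_eq_of_isUnit_add [StarModule ℝ A] [ContinuousStar A]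
    (hπ : Topology.IsEmbedding π) {v w : unitary A} (h : IsUnit (1 + (w : A) * star (v : A))) :
    (v : ConnectedComponents (unitary A)) = w := by
  have h1 := connectedComponents_mk_one_eq_of_isUnit_one_add hπ (w := w * star v) h
  have hc : Continuous fun u : unitary A => u * v := by fun_prop
  have h2 := connectedComponents_mk_map_eq hc h1
  simpa [mul_assoc] using h2

theorem connectedComponents_mk_eq_of_polar [StarModule ℝ A] [ContinuousStar A]
    (hπ : Topology.IsEmbedding π) {a p : A} {v w : unitary A} (hp : IsPos π p) (ha : a = p * w)
    (h : IsPos π (a * star (v : A) + star (a * star (v : A)))) :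
    (v : ConnectedComponents (unitary A)) = w := by
  refine connectedComponents_mk_eq_of_isUnit_add hπ
    (isUnit_of_isPos_mul_add hπ.injective (p := p) (π := π) ?_)
  have hps := hp.star_eq hπ.injective
  convert (hp.add hp).add h using 1
  rw [ha]
  simp only [star_add, star_mul, star_star, star_one, mul_add, add_mul, hps, mul_one, one_mul,
    mul_assoc]
  abel

theorem connectedComponents_mk_eq_of_toUnits [StarModule ℝ A] [ContinuousStar A]
    (hπ : Topology.IsEmbedding π) {v w : unitary A}
    (h : (Unitary.toUnits v : ConnectedComponents Aˣ) = Unitary.toUnits w) :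
    (v : ConnectedComponents (unitary A)) = w := by
  choose p hp W hW using exists_polar (π := π) hπ.injective
  have hloc : IsLocallyConstant fun a : Aˣ => (W a : ConnectedComponents (unitary A)) := by
    refine (IsLocallyConstant.iff_eventually_eq _).mpr fun b => ?_
    have hcont : Continuous fun a : Aˣ => (a : A) * star (W b : A) :=
      Units.continuous_val.mul continuous_const
    have hb : IsPos π ((b : A) * star (W b : A) + star ((b : A) * star (W b : A))) := by
      have : (b : A) * star (W b : A) = p b := by
        rw [hW b, mul_assoc, Unitary.mul_star_self_of_mem (SetLike.coe_mem _), mul_one]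
      rw [this, (hp b).star_eq hπ.injective]
      exact (hp b).add (hp b)
    filter_upwards [hcont.continuousAt.eventually
      ((isOpen_setOf_isPos_add_star hπ.continuous).mem_nhds hb)] with a ha
    exact (connectedComponents_mk_eq_of_polar hπ (hp a) (hW a) ha).symm
  have hW' : ∀ u : unitary A, (u : ConnectedComponents (unitary A)) = W (Unitary.toUnits u) := by
    intro u
    refine connectedComponents_mk_eq_of_polar hπ (hp _) (hW _) ?_
    rw [Unitary.val_toUnits_apply, Unitary.mul_star_self_of_mem (SetLike.coe_mem _), star_one]
    exact IsPos.one.add IsPos.one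
  rw [hW' v, hW' w]
  have hmem : Unitary.toUnits w ∈ connectedComponent (Unitary.toUnits v) :=
    ConnectedComponents.coe_eq_coe.mp h ▸ mem_connectedComponent
  exact hloc.apply_eq_of_isPreconnected isPreconnected_connectedComponent
    mem_connectedComponent hmem

end Components

section Orthogonal

variable {A : Type*} [Ring A] [StarRing A]

theorem form_mulVec_mulVec (M : Matrix (Fin 2) (Fin 2) A) (x y : Fin 2 → A) :
    form (M *ᵥ x) (M *ᵥ y) = star x ⬝ᵥ ((Mᴴ * Omega A * M) *ᵥ y) := by
  rw [form, Matrix.star_mulVec, ← Matrix.dotProduct_mulVec, Matrix.mulVec_mulVec,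
    Matrix.mulVec_mulVec]

theorem mem_O11_iff {g : (Matrix (Fin 2) (Fin 2) A)ˣ} :
    g ∈ O11 A ↔ g.valᴴ * Omega A * g.val = Omega A := by
  constructor
  · intro h
    ext i j
    have h1 : form (g.val *ᵥ Pi.single i 1) (g.val *ᵥ Pi.single j 1) =
        form (Pi.single i (1 : A)) (Pi.single j 1) := h _ _
    rw [form_mulVec_mulVec, form, ← Pi.single_star, star_one, single_one_dotProduct,
      single_one_dotProduct, Matrix.mulVec_single_one, Matrix.mulVec_single_one] at h1
    exact h1
  · intro h x y
    rw [form_mulVec_mulVec, h, form]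

omit [StarRing A] in
theorem Omega_mul_self : Omega A * Omega A = 1 := by
  ext i j; fin_cases i <;> fin_cases j <;> simp [Omega]

theorem O11.inv_val (g : O11 A) :
    (g.val⁻¹).val = Omega A * g.val.valᴴ * Omega A := by
  refine Units.inv_eq_of_mul_eq_one_left ?_
  rw [mul_assoc, mul_assoc, ← mul_assoc _ (Omega A), mem_O11_iff.mp g.2, Omega_mul_self]

theorem O11.mul_Omega_mul (g : O11 A) :
    g.val.val * Omega A * g.val.valᴴ = Omega A := by
  have h : g.val.val * (g.val⁻¹).val = 1 := Units.mul_inv _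
  rw [O11.inv_val] at h
  calc g.val.val * Omega A * g.val.valᴴ
      = g.val.val * (Omega A * g.val.valᴴ * Omega A) * Omega A := by
        simp only [mul_assoc, Omega_mul_self, mul_one]
    _ = Omega A := by rw [h, one_mul]

theorem O11.relations (g : O11 A) :
    star (g.val.val 0 0) * g.val.val 1 0 + star (g.val.val 1 0) * g.val.val 0 0 = 0 ∧
    star (g.val.val 0 1) * g.val.val 1 1 + star (g.val.val 1 1) * g.val.val 0 1 = 0 ∧
    star (g.val.val 0 0) * g.val.val 1 1 + star (g.val.val 1 0) * g.val.val 0 1 = 1 ∧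
    star (g.val.val 0 1) * g.val.val 1 0 + star (g.val.val 1 1) * g.val.val 0 0 = 1 := by
  have h := mem_O11_iff.mp g.2
  have h' : ∀ i j, (g.val.valᴴ * Omega A * g.val.val) i j = Omega A i j := fun i j => by rw [h]
  have h00 := h' 0 0
  have h01 := h' 0 1
  have h10 := h' 1 0
  have h11 := h' 1 1
  simp only [Matrix.mul_apply, Fin.sum_univ_two, Matrix.conjTranspose_apply, Omega,
    Matrix.of_apply, Matrix.cons_val', Matrix.cons_val_zero, Matrix.cons_val_one,
    Matrix.cons_val_fin_one, mul_zero, mul_one, zero_add, add_zero] at h00 h01 h10 h11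
  refine ⟨?_, ?_, ?_, ?_⟩
  · rw [add_comm]; exact h00
  · rw [add_comm]; exact h11
  · rw [add_comm]; exact h01
  · rw [add_comm]; exact h10

theorem O11.bottom_row_relation (g : O11 A) :
    g.val.val 1 0 * star (g.val.val 1 1) + g.val.val 1 1 * star (g.val.val 1 0) = 0 := by
  have h := congrFun (congrFun (O11.mul_Omega_mul g) 1) 1
  simp only [Matrix.mul_apply, Fin.sum_univ_two, Matrix.conjTranspose_apply, Omega,
    Matrix.of_apply, Matrix.cons_val', Matrix.cons_val_zero, Matrix.cons_val_one,
    Matrix.cons_val_fin_one, mul_zero, mul_one, zero_add, add_zero] at h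
  rw [add_comm]; exact h

variable [Algebra ℝ A] [FiniteDimensional ℝ A]

theorem exists_O11_of_entries {a b c d : A} (h1 : star a * c + star c * a = 0)
    (h2 : star b * d + star d * b = 0) (h3 : star a * d + star c * b = 1) :
    ∃ g : O11 A, g.val.val = !![a, b; c, d] := by
  have h4 : star b * c + star d * a = 1 := by
    rw [← star_one A, ← h3]; simp [add_comm]
  have hM : (!![a, b; c, d])ᴴ * Omega A * !![a, b; c, d] = Omega A := by
    ext i j
    fin_cases i <;> fin_cases j <;>
      simp [Matrix.mul_apply, Fin.sum_univ_two, Omega, h1, h2, h3, h4, add_comm]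
  have := IsArtinianRing.of_finite ℝ (Matrix (Fin 2) (Fin 2) A)
  have hu : (Omega A * (!![a, b; c, d])ᴴ * Omega A) * !![a, b; c, d] = 1 := by
    rw [mul_assoc, mul_assoc, ← mul_assoc _ (Omega A), hM, Omega_mul_self]
  refine ⟨⟨⟨!![a, b; c, d], _, mul_eq_one_symm hu, hu⟩, ?_⟩, rfl⟩
  exact mem_O11_iff.mpr hM

/-- The element of `O_{(1,1)}(A, σ)` with the given entries. -/
noncomputable def O11.ofEntries (a b c d : A) (h1 : star a * c + star c * a = 0)
    (h2 : star b * d + star d * b = 0) (h3 : star a * d + star c * b = 1) : O11 A :=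
  (exists_O11_of_entries h1 h2 h3).choose

theorem O11.val_ofEntries {a b c d : A} (h1 : star a * c + star c * a = 0)
    (h2 : star b * d + star d * b = 0) (h3 : star a * d + star c * b = 1) :
    (O11.ofEntries a b c d h1 h2 h3).val.val = !![a, b; c, d] :=
  (exists_O11_of_entries h1 h2 h3).choose_spec

variable [StarModule ℝ A]

omit [FiniteDimensional ℝ A] in
theorem ofUnitary_relation (u v : unitary A) :
    star ((2⁻¹ : ℝ) • (u + v : A)) * ((2⁻¹ : ℝ) • (u - v : A)) +
      star ((2⁻¹ : ℝ) • (u - v : A)) * ((2⁻¹ : ℝ) • (u + v : A)) = 0 := by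
  simp only [star_smul, star_trivial, smul_mul_smul_comm, ← smul_add, star_add, star_sub,
    add_mul, mul_add, sub_mul, mul_sub, Unitary.star_mul_self_of_mem (SetLike.coe_mem _)]
  rw [smul_eq_zero]
  right
  abel

omit [FiniteDimensional ℝ A] in
theorem ofUnitary_relation_one (u v : unitary A) :
    star ((2⁻¹ : ℝ) • (u + v : A)) * ((2⁻¹ : ℝ) • (u + v : A)) +
      star ((2⁻¹ : ℝ) • (u - v : A)) * ((2⁻¹ : ℝ) • (u - v : A)) = 1 := by
  simp only [star_smul, star_trivial, smul_mul_smul_comm, ← smul_add, star_add, star_sub,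
    add_mul, mul_add, sub_mul, mul_sub, Unitary.star_mul_self_of_mem (SetLike.coe_mem _)]
  rw [inv_mul_eq_iff_eq_mul₀ two_ne_zero |>.mpr (by norm_num : (2⁻¹ : ℝ) = 2 * 4⁻¹)]
  have : ∀ x y : A, 1 + x + (y + 1) + (1 - x - (y - 1)) = (4 : ℝ) • (1 : A) := by
    intro x y
    have h4 : (4 : ℝ) • (1 : A) = 1 + 1 + 1 + 1 := by
      rw [show (4 : ℝ) = 1 + 1 + 1 + 1 by norm_num]; simp only [add_smul, one_smul]
    rw [h4]; abel
  rw [this, smul_smul]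
  norm_num

/-- The embedding of `U(A, σ) × U(A, σ)` in `O_{(1,1)}(A, σ)`. -/
noncomputable def O11.ofUnitary (u v : unitary A) : O11 A :=
  O11.ofEntries ((2⁻¹ : ℝ) • (u + v : A)) ((2⁻¹ : ℝ) • (u - v : A)) ((2⁻¹ : ℝ) • (u - v : A))
    ((2⁻¹ : ℝ) • (u + v : A)) (ofUnitary_relation u v)
    (by rw [add_comm]; exact ofUnitary_relation u v) (ofUnitary_relation_one u v)

theorem O11.val_ofUnitary (u v : unitary A) : (O11.ofUnitary u v).val.val =
    !![(2⁻¹ : ℝ) • (u + v : A), (2⁻¹ : ℝ) • (u - v : A);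
      (2⁻¹ : ℝ) • (u - v : A), (2⁻¹ : ℝ) • (u + v : A)] :=
  O11.val_ofEntries _ _ _

variable {n : ℕ} {π : A →⋆ₐ[ℝ] Matrix (Fin n) (Fin n) ℝ}

omit [StarModule ℝ A] in
theorem isUnit_of_star_mul_add_star_mul (hπ : Function.Injective π) {p q : A}
    (h : star p * q + star q * p = 1 + 1) : IsUnit q := by
  refine isUnit_of_isPos_mul_add hπ (p := star p) (π := π) ?_
  rw [star_star, h]
  exact IsPos.one.add IsPos.one

omit [StarModule ℝ A] in
theorem isUnit_add_of_star_mul_add_star_mul (hπ : Function.Injective π) {p q : A}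
    (h : star p * q + star q * p = 1 + 1) : IsUnit (p + q) := by
  have h2 : star (p + q) * (p + q) = 1 + (1 + (1 + (1 + star (p - q) * (p - q)))) := by
    have e : star (p + q) * (p + q) = (star p * q + star q * p) + (star p * q + star q * p) +
        star (p - q) * (p - q) := by
      simp only [star_add, star_sub, add_mul, mul_add, sub_mul, mul_sub]
      abel
    rw [e, h]
    abel
  have h3 : IsPos π (star (p + q) * (p + q)) := by
    rw [h2]
    exact IsPos.one.add (IsPos.one.add (IsPos.one.add (IsPos.one_add_star_mul_self _)))
  refine isUnit_of_isPos_mul_add hπ (p := star (p + q)) (π := π) ?_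
  rw [star_star]
  exact h3.add h3

omit [Algebra ℝ A] [FiniteDimensional ℝ A] [StarModule ℝ A] in
theorem O11.sum_relation (g : O11 A) :
    star (g.val.val 0 0 + g.val.val 0 1) * (g.val.val 1 0 + g.val.val 1 1) +
      star (g.val.val 1 0 + g.val.val 1 1) * (g.val.val 0 0 + g.val.val 0 1) = 1 + 1 := by
  obtain ⟨h1, h2, h3, h4⟩ := O11.relations g
  calc _ = (star (g.val.val 0 0) * g.val.val 1 0 + star (g.val.val 1 0) * g.val.val 0 0) +
        (star (g.val.val 0 1) * g.val.val 1 1 + star (g.val.val 1 1) * g.val.val 0 1) +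
        ((star (g.val.val 0 0) * g.val.val 1 1 + star (g.val.val 1 0) * g.val.val 0 1) +
        (star (g.val.val 0 1) * g.val.val 1 0 + star (g.val.val 1 1) * g.val.val 0 0)) := by
        simp only [star_add, add_mul, mul_add]; abel
    _ = _ := by rw [h1, h2, h3, h4]; abel

omit [Algebra ℝ A] [FiniteDimensional ℝ A] [StarModule ℝ A] in
theorem O11.difference_relation (g : O11 A) :
    star (g.val.val 0 0 - g.val.val 0 1) * (g.val.val 1 1 - g.val.val 1 0) +
      star (g.val.val 1 1 - g.val.val 1 0) * (g.val.val 0 0 - g.val.val 0 1) = 1 + 1 := by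
  obtain ⟨h1, h2, h3, h4⟩ := O11.relations g
  calc _ = -(star (g.val.val 0 0) * g.val.val 1 0 + star (g.val.val 1 0) * g.val.val 0 0) -
        (star (g.val.val 0 1) * g.val.val 1 1 + star (g.val.val 1 1) * g.val.val 0 1) +
        ((star (g.val.val 0 0) * g.val.val 1 1 + star (g.val.val 1 0) * g.val.val 0 1) +
        (star (g.val.val 0 1) * g.val.val 1 0 + star (g.val.val 1 1) * g.val.val 0 0)) := by
        simp only [star_sub, sub_mul, mul_sub]; abel
    _ = _ := by rw [h1, h2, h3, h4]; abel

/-- The element `(a + b + c + d) / 2` of `A` attached to a matrix with entries `a, b, c, d`. -/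
noncomputable def sumHalf (M : Matrix (Fin 2) (Fin 2) A) : A :=
  (2⁻¹ : ℝ) • ((M 0 0 + M 0 1) + (M 1 0 + M 1 1))

/-- The element `(a - b - c + d) / 2` of `A` attached to a matrix with entries `a, b, c, d`. -/
noncomputable def diffHalf (M : Matrix (Fin 2) (Fin 2) A) : A :=
  (2⁻¹ : ℝ) • ((M 0 0 - M 0 1) + (M 1 1 - M 1 0))

omit [StarRing A] [FiniteDimensional ℝ A] [StarModule ℝ A] in
theorem isUnit_half_smul {x : A} (h : IsUnit x) : IsUnit ((2⁻¹ : ℝ) • x) := by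
  rw [Algebra.smul_def]
  exact ((IsUnit.mk0 (2⁻¹ : ℝ) (by norm_num)).map (algebraMap ℝ A)).mul h

omit [StarModule ℝ A] in
theorem O11.isUnit_sumHalf (hπ : Function.Injective π) (g : O11 A) :
    IsUnit (sumHalf g.val.val) :=
  isUnit_half_smul (isUnit_add_of_star_mul_add_star_mul hπ (O11.sum_relation g))

omit [StarModule ℝ A] in
theorem O11.isUnit_diffHalf (hπ : Function.Injective π) (g : O11 A) :
    IsUnit (diffHalf g.val.val) :=
  isUnit_half_smul (isUnit_add_of_star_mul_add_star_mul hπ (O11.difference_relation g))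

theorem sumHalf_ofUnitary (u v : unitary A) : sumHalf (O11.ofUnitary u v).val.val = u := by
  rw [sumHalf, O11.val_ofUnitary]
  simp only [Matrix.of_apply, Matrix.cons_val', Matrix.cons_val_zero, Matrix.cons_val_one,
    Matrix.cons_val_fin_one]
  module

theorem diffHalf_ofUnitary (u v : unitary A) : diffHalf (O11.ofUnitary u v).val.val = v := by
  rw [diffHalf, O11.val_ofUnitary]
  simp only [Matrix.of_apply, Matrix.cons_val', Matrix.cons_val_zero, Matrix.cons_val_one,
    Matrix.cons_val_fin_one]
  module

omit [Algebra ℝ A] [FiniteDimensional ℝ A] [StarModule ℝ A] in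
theorem O11.bottom_row_mul_star (g : O11 A) :
    (g.val.val 1 0 + g.val.val 1 1) * star (g.val.val 1 0 + g.val.val 1 1) =
      (g.val.val 1 1 - g.val.val 1 0) * star (g.val.val 1 1 - g.val.val 1 0) := by
  have h := O11.bottom_row_relation g
  rw [← sub_eq_zero]
  calc _ = (g.val.val 1 0 * star (g.val.val 1 1) + g.val.val 1 1 * star (g.val.val 1 0)) +
        (g.val.val 1 0 * star (g.val.val 1 1) + g.val.val 1 1 * star (g.val.val 1 0)) := by
        simp only [star_add, star_sub, add_mul, mul_add, sub_mul, mul_sub]; abel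
    _ = 0 := by rw [h, add_zero]

/-- The bottom row of an element of `O_{(1,1)}(A, σ)` is a positive multiple of that of an element
of the maximal compact subgroup. -/
theorem O11.exists_mul_ofUnitary (hπ : Function.Injective π) (g : O11 A) :
    ∃ (q : O11 A) (u v : unitary A), IsPos π (q.val.val 1 1) ∧ q.val.val 1 0 = 0 ∧
      g = q * O11.ofUnitary u v := by
  obtain ⟨y, hy⟩ := isUnit_of_star_mul_add_star_mul hπ (O11.sum_relation g)
  obtain ⟨z, hz⟩ := isUnit_of_star_mul_add_star_mul hπ (O11.difference_relation g)
  obtain ⟨p, hp, u, hu⟩ := exists_polar (π := π) hπ y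
  have hps := hp.star_eq hπ
  have hpp : p * p = z * star (z : A) := by
    rw [hz, ← O11.bottom_row_mul_star g, ← hy, hu, star_mul, hps, mul_assoc, ← mul_assoc (u : A),
      Unitary.mul_star_self_of_mem (SetLike.coe_mem _), one_mul]
  obtain ⟨r, rfl⟩ := hp.isUnit hπ
  have hv : ↑r⁻¹ * (z : A) ∈ unitary A := by
    refine (r⁻¹ * z).isUnit.mem_unitary_iff_mul_star_self.mpr ?_
    rw [Units.val_mul, star_mul, star_val_inv_of_star_eq hps, mul_assoc, ← mul_assoc (z : A),
      ← hpp]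
    simp
  let v : unitary A := ⟨↑r⁻¹ * z, hv⟩
  have hvz : (r : A) * v = z := by simp [v]
  have hrow : ![0, (r : A)] ᵥ* (O11.ofUnitary u v).val.val = g.val.val 1 := by
    rw [O11.val_ofUnitary]
    ext j
    fin_cases j
    · simp [Matrix.vecMul, dotProduct, Fin.sum_univ_two, mul_sub, hvz, ← hu, hy, hz]
      module
    · simp [Matrix.vecMul, dotProduct, Fin.sum_univ_two, mul_add, hvz, ← hu, hy, hz]
      module
  have hq : (g * (O11.ofUnitary u v)⁻¹).val.val 1 = ![0, (r : A)] := by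
    change (g.val.val * ((O11.ofUnitary u v).val⁻¹).val) 1 = _
    rw [Matrix.mul_apply_eq_vecMul, ← hrow, Matrix.vecMul_vecMul, Units.mul_inv,
      Matrix.vecMul_one]
  refine ⟨g * (O11.ofUnitary u v)⁻¹, u, v, ?_, ?_, by simp⟩
  · rw [hq]; exact hp
  · rw [hq]; rfl

end Orthogonal

section OrthogonalComponents

variable {A : Type*} [Ring A] [StarRing A] [Algebra ℝ A] [StarModule ℝ A] [FiniteDimensional ℝ A]
  [TopologicalSpace A] [IsTopologicalRing A] [ContinuousStar A] [ContinuousSMul ℝ A]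
  {n : ℕ} {π : A →⋆ₐ[ℝ] Matrix (Fin n) (Fin n) ℝ}

omit [Algebra ℝ A] [StarModule ℝ A] [FiniteDimensional ℝ A] [ContinuousSMul ℝ A] in
theorem continuous_O11_of_continuous_val {X : Type*} [TopologicalSpace X] {f : X → O11 A}
    (hf : Continuous fun x => (f x).val.val) : Continuous f := by
  refine Continuous.subtype_mk (f := fun x => (f x).val) (Units.continuous_iff.mpr ⟨hf, ?_⟩) _
  have h : ∀ x, ((f x).val⁻¹).val = Omega A * (f x).val.valᴴ * Omega A := fun x => O11.inv_val _
  refine (continuous_congr h).mpr ?_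
  exact (continuous_const.matrix_mul hf.matrix_conjTranspose).matrix_mul continuous_const

omit [Algebra ℝ A] [StarModule ℝ A] [FiniteDimensional ℝ A] [ContinuousStar A]
  [IsTopologicalRing A] [ContinuousSMul ℝ A] in
theorem continuous_O11_val : Continuous fun g : O11 A => g.val.val :=
  Units.continuous_val.comp continuous_subtype_val

theorem connectedComponents_mk_one_eq_of_triangular (hπ : Topology.IsEmbedding π) {q : O11 A}
    (h0 : q.val.val 1 0 = 0) (hp : IsPos π (q.val.val 1 1)) :
    ((1 : O11 A) : ConnectedComponents (O11 A)) = q := by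
  obtain ⟨-, h2, h3, -⟩ := O11.relations q
  set p := q.val.val 1 1 with hpdef
  set b := q.val.val 0 1 with hbdef
  have hps := hp.star_eq hπ.injective
  have hskew : star (p * b) + p * b = 0 := by rw [← h2, star_mul, hps]
  let P : unitInterval → Aˣ := fun t =>
    ((IsPos.one.convexComb hp t.2).isUnit hπ.injective).unit
  have hPval : ∀ t, (P t : A) = (1 - (t : ℝ)) • 1 + (t : ℝ) • p := fun t => rfl
  have hPstar : ∀ t, star (P t : A) = P t := fun t =>
    (IsPos.one.convexComb hp t.2).star_eq hπ.injective
  have hPcont : Continuous P := by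
    refine continuous_units_of_continuous_val hπ ?_
    simp_rw [hPval]
    fun_prop
  let Q : unitInterval → O11 A := fun t =>
    O11.ofEntries (↑(P t)⁻¹) ((t : ℝ) • (↑(P t)⁻¹ * (p * b))) 0 (P t) (by simp)
      (by
        rw [star_smul, star_trivial, star_mul, star_val_inv_of_star_eq (hPstar t), hPstar,
          smul_mul_assoc, mul_smul_comm, Units.inv_mul_cancel_right, Units.mul_inv_cancel_left,
          ← smul_add, hskew, smul_zero])
      (by rw [star_val_inv_of_star_eq (hPstar t)]; simp)
  have hQval : ∀ t, (Q t).val.val =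
      !![(↑(P t)⁻¹ : A), (t : ℝ) • (↑(P t)⁻¹ * (p * b)); 0, (P t : A)] :=
    fun t => O11.val_ofEntries _ _ _
  have hQcont : Continuous Q := by
    refine continuous_O11_of_continuous_val ((continuous_congr hQval).mpr ?_)
    have hi : Continuous fun t => (↑(P t)⁻¹ : A) := Units.continuous_val.comp hPcont.inv
    have hv : Continuous fun t => (P t : A) := Units.continuous_val.comp hPcont
    refine continuous_matrix fun i j => ?_
    fin_cases i <;> fin_cases j
    · exact hi
    · exact continuous_subtype_val.smul (hi.mul continuous_const)
    · exact continuous_const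
    · exact hv
  have hP0 : P 0 = 1 := Units.ext (by simp [hPval])
  have hP1 : (P 1 : A) = p := by simp [hPval]
  have h00 : (↑(P 1)⁻¹ : A) = q.val.val 0 0 := by
    rw [h0, star_zero, zero_mul, add_zero] at h3
    have : p * q.val.val 0 0 = 1 := by
      rw [← star_one A, ← h3, star_mul, star_star, hps]
    exact Units.inv_eq_of_mul_eq_one_right (by rw [hP1, this])
  convert connectedComponents_mk_eq_of_path hQcont
  · refine Subtype.ext (Units.ext ?_)
    rw [hQval, hP0]
    simp [Matrix.one_fin_two]
  · refine Subtype.ext (Units.ext ?_)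
    rw [hQval, h00]
    ext i j
    fin_cases i <;> fin_cases j
    · rfl
    · change b = ((1 : unitInterval) : ℝ) • (_ * (p * b))
      rw [← h00, ← hP1, Units.inv_mul_cancel_left, Set.Icc.coe_one, one_smul]
    · exact h0
    · exact hP1.symm

theorem exists_connectedComponents_mk_eq_ofUnitary (hπ : Topology.IsEmbedding π) (g : O11 A) :
    ∃ u v : unitary A, (g : ConnectedComponents (O11 A)) = O11.ofUnitary u v := by
  obtain ⟨q, u, v, hq, h0, rfl⟩ := O11.exists_mul_ofUnitary hπ.injective g
  refine ⟨u, v, ?_⟩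
  have hc : Continuous fun x : O11 A => x * O11.ofUnitary u v := by fun_prop
  have := connectedComponents_mk_map_eq hc
    (connectedComponents_mk_one_eq_of_triangular hπ h0 hq)
  rw [← this, one_mul]

omit [ContinuousSMul ℝ A] in
theorem continuous_ofUnitary :
    Continuous fun w : unitary A × unitary A => O11.ofUnitary w.1 w.2 := by
  refine continuous_O11_of_continuous_val ?_
  simp_rw [O11.val_ofUnitary]
  have h1 : Continuous fun w : unitary A × unitary A => (2⁻¹ : ℝ) • (w.1 + w.2 : A) := by fun_prop
  have h2 : Continuous fun w : unitary A × unitary A => (2⁻¹ : ℝ) • (w.1 - w.2 : A) := by fun_prop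
  refine continuous_matrix fun i j => ?_
  fin_cases i <;> fin_cases j
  · exact h1
  · exact h2
  · exact h2
  · exact h1

/-- The two diagonal blocks of an element of `O_{(1,1)}(A, σ)` in the basis diagonalising `ω`. -/
noncomputable def O11.toUnitsProd (hπ : Function.Injective π) (g : O11 A) : Aˣ × Aˣ :=
  ((O11.isUnit_sumHalf hπ g).unit, (O11.isUnit_diffHalf hπ g).unit)

omit [StarModule ℝ A] [ContinuousStar A] [ContinuousSMul ℝ A] in
theorem continuous_toUnitsProd (hπ : Topology.IsEmbedding π) :
    Continuous (O11.toUnitsProd hπ.injective : O11 A → Aˣ × Aˣ) := by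
  have hij : ∀ i j, Continuous fun g : O11 A => g.val.val i j :=
    fun i j => continuous_O11_val.matrix_elem i j
  refine Continuous.prodMk (continuous_units_of_continuous_val hπ ?_)
    (continuous_units_of_continuous_val hπ ?_)
  · exact (((hij 0 0).add (hij 0 1)).add ((hij 1 0).add (hij 1 1))).const_smul _
  · exact (((hij 0 0).sub (hij 0 1)).add ((hij 1 1).sub (hij 1 0))).const_smul _

omit [TopologicalSpace A] [IsTopologicalRing A] [ContinuousStar A] [ContinuousSMul ℝ A] in
theorem toUnitsProd_ofUnitary (hπ : Function.Injective π) (u v : unitary A) :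
    O11.toUnitsProd hπ (O11.ofUnitary u v) = (Unitary.toUnits u, Unitary.toUnits v) :=
  Prod.ext (Units.ext (sumHalf_ofUnitary u v)) (Units.ext (diffHalf_ofUnitary u v))

theorem bijective_connectedComponents_toUnitsProd (hπ : Topology.IsEmbedding π) :
    Function.Bijective fun c : ConnectedComponents (O11 A) =>
      ((continuous_fst.comp (continuous_toUnitsProd hπ)).connectedComponentsMap c,
        (continuous_snd.comp (continuous_toUnitsProd hπ)).connectedComponentsMap c) := by
  constructor
  · intro c c' h
    obtain ⟨g, rfl⟩ := ConnectedComponents.surjective_coe c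
    obtain ⟨g', rfl⟩ := ConnectedComponents.surjective_coe c'
    obtain ⟨u, v, hg⟩ := exists_connectedComponents_mk_eq_ofUnitary hπ g
    obtain ⟨u', v', hg'⟩ := exists_connectedComponents_mk_eq_ofUnitary hπ g'
    rw [hg, hg'] at h ⊢
    simp only [Continuous.connectedComponentsMap_mk, Function.comp_apply, toUnitsProd_ofUnitary,
      Prod.mk.injEq] at h
    have h1 := connectedComponents_mk_eq_of_toUnits hπ h.1
    have h2 := connectedComponents_mk_eq_of_toUnits hπ h.2
    exact (connectedComponents_mk_map_eq (f := fun w : unitary A => O11.ofUnitary w v)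
      (continuous_ofUnitary.comp (by fun_prop : Continuous fun w => (w, v))) h1).trans
      (connectedComponents_mk_map_eq (f := fun w : unitary A => O11.ofUnitary u' w)
      (continuous_ofUnitary.comp (by fun_prop : Continuous fun w => (u', w))) h2)
  · rintro ⟨c, c'⟩
    obtain ⟨a, rfl⟩ := ConnectedComponents.surjective_coe c
    obtain ⟨a', rfl⟩ := ConnectedComponents.surjective_coe c'
    obtain ⟨u, hu⟩ := exists_unitary_connectedComponents_mk_eq hπ a
    obtain ⟨v, hv⟩ := exists_unitary_connectedComponents_mk_eq hπ a'
    refine ⟨(O11.ofUnitary u v : O11 A), ?_⟩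
    simp only [Continuous.connectedComponentsMap_mk, Function.comp_apply, toUnitsProd_ofUnitary,
      hu, hv]

theorem connectedSpace_iff_card_connectedComponents (X : Type*) [TopologicalSpace X] :
    ConnectedSpace X ↔ ENat.card (ConnectedComponents X) = 1 := by
  rw [ENat.card_eq_one_iff_unique, unique_iff_subsingleton_and_nonempty (α := ConnectedComponents X),
    connectedSpace_iff_connectedComponent]
  constructor
  · rintro ⟨x, hx⟩
    refine ⟨⟨?_⟩, ⟨(x : ConnectedComponents X)⟩⟩
    have h : ∀ c : ConnectedComponents X, c = x := by
      intro c
      obtain ⟨y, rfl⟩ := ConnectedComponents.surjective_coe c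
      exact ConnectedComponents.coe_eq_coe'.mpr (hx ▸ Set.mem_univ y)
    exact fun c c' => (h c).trans (h c').symm
  · rintro ⟨h, ⟨c⟩⟩
    obtain ⟨x, rfl⟩ := ConnectedComponents.surjective_coe c
    exact ⟨x, Set.eq_univ_of_forall fun y =>
      ConnectedComponents.coe_eq_coe'.mp (Subsingleton.elim _ _)⟩

theorem enat_sq_eq_one_iff (x : ℕ∞) : x ^ 2 = 1 ↔ x = 1 := by
  cases x with
  | top => simp
  | coe k =>
    norm_cast
    simp

end OrthogonalComponents

end HermAlg

theorem mainTheorem4 (A : Type*) [Ring A] [Algebra ℝ A] [FiniteDimensional ℝ A]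
    [IsSemisimpleRing A] [StarRing A] [StarModule ℝ A]
    [TopologicalSpace A] [IsTopologicalAddGroup A] [ContinuousSMul ℝ A] [T2Space A]
    (hHerm : HermAlg.IsHermitian A)
    (hpos : ∀ a : Aˣ, (a : A) * star (a : A) ∈ HermAlg.nonnegCone A) :
    (∀ n : ℕ, ENat.card (ConnectedComponents Aˣ) = n →
      ENat.card (ConnectedComponents (HermAlg.O11 A)) = (n : ℕ∞) ^ 2) ∧
    (ConnectedSpace (HermAlg.O11 A) ↔ ConnectedSpace Aˣ) := by
  obtain ⟨m, π, hinj⟩ := HermAlg.exists_injective_starAlgHom_matrix hHerm hpos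
  have hπ : Topology.IsEmbedding π :=
    (LinearMap.isClosedEmbedding_of_injective (f := (π : A →ₗ[ℝ] Matrix (Fin m) (Fin m) ℝ))
      (LinearMap.ker_eq_bot.mpr hinj)).isEmbedding
  have hmul : ContinuousMul A := ⟨by
    refine hπ.continuous_iff.mpr ?_
    have : (π ∘ fun p : A × A => p.1 * p.2) = fun p => π p.1 * π p.2 :=
      funext fun p => map_mul π _ _
    rw [this]
    exact (hπ.continuous.comp continuous_fst).matrix_mul (hπ.continuous.comp continuous_snd)⟩
  have hring : IsTopologicalRing A := {}
  have hstar : ContinuousStar A :=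
    ⟨(starLinearEquiv ℝ (A := A)).toLinearMap.continuous_of_finiteDimensional⟩
  have hcard : ENat.card (ConnectedComponents (HermAlg.O11 A)) =
      ENat.card (ConnectedComponents Aˣ) ^ 2 := by
    rw [ENat.card_congr (Equiv.ofBijective _
      (HermAlg.bijective_connectedComponents_toUnitsProd hπ)), ENat.card_prod, pow_two]
  refine ⟨fun n hn => by rw [hcard, hn], ?_⟩
  rw [HermAlg.connectedSpace_iff_card_connectedComponents,
    HermAlg.connectedSpace_iff_card_connectedComponents, hcard]
  exact HermAlg.enat_sq_eq_one_iff _
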